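/- **Model.** There are $N$ D2D links and $M$ bit rates $\mathsf R_1,\dots,\mathsf R_M\ge 0$ with SNR thresholds $\mathsf S_1,\dots,\mathsf S_M>0$; $\mathsf R_{\min}$ and $\mathsf R_{\max}$ denote the smallest and the largest rate. Let $N_o>0$ be the noise power, $L_n>0$ the path-loss term of link $n$, $P_{\max}>0$ the maximal power and $R_{th}\ge 0$ the throughput threshold. With fading coefficient $h_n\in\mathbb C$, link $n$ achieves the rate $\mathsf R_m$ with the power $P_{n,m}=\min\{\mathsf S_mN_o/(|h_n|^2L_n),\,P_{\max}\}$ (which is $P_{\max}$ if $h_n=0$). The vectors $H(t)=(h_1(t),\dots,h_N(t))$, $t=1,2,\dots$, are i.i.d. over the slots with an arbitrary joint law (for example Rayleigh fading). Formally there is a filtration $(\mathcal F_t)_{t\ge1}$ such that $H(t)$ is $\mathcal F_t$-measurable, $H(t+1)$ is independent of $\mathcal F_t$, and all $H(t)$ have the same law. A (scheduling) *policy* $\Gamma$ selects in each slot $t$, in an $\mathcal F_t$-measurable way, exactly one link $n$ and one rate index $m$. For the selected link $R_n(t)=\mathsf R_m$ and $P_n(t)=P_{n,m}(t)$; for all the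 other links $R_n(t)=P_n(t)=0$. Put $$\bar P(\Gamma)=\limsup_{T\to\infty}\frac1T\sum_{t=1}^T\sum_{n=1}^N\mathbb E[P_n(t)],\qquad \bar R_n(\Gamma)=\liminf_{T\to\infty}\frac1T\sum_{t=1}^T\mathbb E[R_n(t)].$$ A policy is *feasible* if $\bar R_n(\Gamma)\ge R_{th}$ for all $n$. The ideal optimum $P^*_{id}$ is the infimum of $\bar P(\Gamma)$ over all feasible policies (these know the instantaneous CSI of all links); assume that a feasible policy exists. The virtual queues are $Q_n(t+1)=[Q_n(t)-R_n(t)]^++R_{th}$, with deterministic initial values $Q_n(1)\ge 0$. **Distributed channel-indexing scheduling.** Let $V>0$. In slot $t$ each link computes $v_n(t)=\min_m\big(VP_{n,m}(t)-Q_n(t)\mathsf R_m\big)$. The interval from $v_{\min}(t)=-tR_{th}\mathsf R_{\max}$ to $v_{\max}=VP_{\max}-R_{th}\mathsf R_{\min}$ carries the grid $a_j=v_{\min}(t)+(j-1)\frac{v_{\max}-v_{\min}(t)}{K-1}$, $1\le j\le K$, where the number $K=K(t)$ of available resource elements is arbitrary and may depend on the slot and on the realization (if $K=1$ the only grid point is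 $v_{\min}(t)$). Link $n$ sends its CSI indicator on the resource element $\tilde k_n(t)$, the largest $j$ with $a_j<v_n(t)$ (and $1$ if there is none). The scheduled link is the one with the lowest $\tilde k_n(t)$ among the links that share their resource element with no other link, and it uses a rate index that attains the minimum in $v_n(t)$. A policy that almost surely acts in this way in every slot is denoted $\Gamma^{dist}$. *No collision* means that almost surely, in every slot, the indices $\tilde k_1(t),\dots,\tilde k_N(t)$ are pairwise distinct. **Statement.** Put $C=\frac12\big(NR_{th}^2+\mathsf R_{\max}^2\big)$, which does not depend on $V$. If no collision occurs under $\Gamma^{dist}$, then $\Gamma^{dist}$ is feasible and $$P^*_{id}\;\le\;\limsup_{T\to\infty}\frac1T\sum_{t=1}^T\sum_{n=1}^N\mathbb E\big[P_n(\Gamma^{dist}(t))\big]\;\le\;P^*_{id}+\frac CV .$$ Moreover, whenever $R_{th}$ is interior to the achievable region, that is, for every $\varepsilon>0$ and every policy $\Gamma$ with $\bar R_n(\Gamma)\ge R_{th}+\varepsilon$ for all $n$, all the virtual queues under $\Gamma^{dist}$ are strongly stable, i.e. $\limsup_T\frac1T\sum_{t=1}^T\mathbb E[Q_n(t)]<\infty$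 for each $n$, and $$\limsup_{T\to\infty}\frac1T\sum_{t=1}^{T}\sum_{n=1}^N\mathbb E[Q_n(t)]\;\le\;\frac{C+V\,\bar P(\Gamma)}{\varepsilon},$$ which is $O(V)$, since $\varepsilon$ and $\Gamma$ do not depend on $V$. -/

import Mathlib

open MeasureTheory ProbabilityTheory Filter
open scoped ENNReal

noncomputable section

namespace D2D

/-- Parameters of an overlay D2D network with `N` links and `M` bit rates: the bit rates `R_m`, the
SNR thresholds `S_m`, the noise power, the path-loss terms `L_n`, the maximal transmission power and
the throughput threshold `R_th`. -/
structure Network (N M : ℕ) where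
  rate : Fin M → ℝ
  snr : Fin M → ℝ
  noise : ℝ
  pathLoss : Fin N → ℝ
  Pmax : ℝ
  Rth : ℝ
  rate_nonneg : ∀ m, 0 ≤ rate m
  snr_pos : ∀ m, 0 < snr m
  noise_pos : 0 < noise
  pathLoss_pos : ∀ n, 0 < pathLoss n
  Pmax_pos : 0 < Pmax
  Rth_nonneg : 0 ≤ Rth

variable {N M : ℕ}

/-- The largest bit rate (`R_M` when the rates are listed in increasing order). -/
def Network.maxRate (S : Network N M) : ℝ := ⨆ m, S.rate m

/-- The smallest bit rate (`R_1` when the rates are listed in increasing order). -/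
def Network.minRate (S : Network N M) : ℝ := ⨅ m, S.rate m

/-- The power `P_{n,m} = min {S_m N_o / (|h|² L_n), P_max}` with which link `n` achieves the bit rate
`R_m` when its fading coefficient is `h`; for `h = 0` the first term is infinite. -/
def Network.power (S : Network N M) (n : Fin N) (m : Fin M) (h : ℂ) : ℝ :=
  open Classical in
  if h = 0 then S.Pmax else min (S.snr m * S.noise / (‖h‖ ^ 2 * S.pathLoss n)) S.Pmax

/-- The constant `C = (N R_th² + R_M²) / 2`. It bounds `∑_i (R_th² + R_i(t)²) / 2`, because one link
is served per slot. -/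
def Network.C (S : Network N M) : ℝ := (N * S.Rth ^ 2 + S.maxRate ^ 2) / 2

/-! ### Channels, scheduling policies, virtual queues

Time is indexed by `t : ℕ`, where the index `t` stands for the slot number `t + 1` (slots are
numbered `1, 2, 3, …`). -/

section Dynamics

variable {Ω : Type*} {mΩ : MeasurableSpace Ω}

/-- The vectors `H t = (h_1, …, h_N)` of fading coefficients are independent and identically
distributed over the slots, relative to the information `ℱ`: `H t` is known in slot `t`, and
`H (t + 1)` is independent of everything known in slot `t`. The common law is arbitrary; Rayleigh
fading is the case in which each coordinate is standard complex Gaussian. -/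
structure IsChannel (μ : Measure Ω) (ℱ : Filtration ℕ mΩ) (H : ℕ → Ω → Fin N → ℂ) : Prop where
  adapted : ∀ t, Measurable[ℱ t] (H t)
  identDistrib : ∀ t, IdentDistrib (H t) (H 0) μ μ
  indep : ∀ t, Indep (MeasurableSpace.comap (H (t + 1)) inferInstance) (ℱ t) μ

/-- A scheduling policy selects in each slot one link and the bit rate of this link, on the basis of
everything known in this slot: in particular the current and past channel states of all links. -/
def IsPolicy (ℱ : Filtration ℕ mΩ) (Γ : ℕ → Ω → Fin N × Fin M) : Prop :=
  ∀ t, Measurable[ℱ t] (Γ t)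

/-- The service rate `R_n(t)`: the chosen bit rate if link `n` is scheduled, and `0` otherwise. -/
def Network.service (S : Network N M) (Γ : ℕ → Ω → Fin N × Fin M) (t : ℕ) (n : Fin N) (ω : Ω) : ℝ :=
  if (Γ t ω).1 = n then S.rate (Γ t ω).2 else 0

/-- The transmission power `P_n(t)`: `P_{n,m}` if link `n` is scheduled with bit rate `R_m`, and `0`
otherwise. -/
def Network.txPower (S : Network N M) (H : ℕ → Ω → Fin N → ℂ) (Γ : ℕ → Ω → Fin N × Fin M)
    (t : ℕ) (n : Fin N) (ω : Ω) : ℝ :=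
  if (Γ t ω).1 = n then S.power n (Γ t ω).2 (H t ω n) else 0

/-- The virtual queues: `Q_n(t+1) = [Q_n(t) - R_n(t)]⁺ + R_th`, with initial backlogs `q₀`. -/
def Network.queue (S : Network N M) (q₀ : Fin N → ℝ) (Γ : ℕ → Ω → Fin N × Fin M) :
    ℕ → Fin N → Ω → ℝ
  | 0, n, _ => q₀ n
  | t + 1, n, ω => max (S.queue q₀ Γ t n ω - S.service Γ t n ω) 0 + S.Rth

/-- The time average of the total power, `limsup_T (1/T) ∑_{t ≤ T} ∑_n E[P_n(t)]`. -/
def Network.avgPower (S : Network N M) (μ : Measure Ω) (H : ℕ → Ω → Fin N → ℂ)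
    (Γ : ℕ → Ω → Fin N × Fin M) : ℝ :=
  limsup (fun T : ℕ => (1 / (T : ℝ)) *
    ∑ t ∈ Finset.range T, ∑ n, ∫ ω, S.txPower H Γ t n ω ∂μ) atTop

/-- The time average of the throughput of link `n`, `liminf_T (1/T) ∑_{t ≤ T} E[R_n(t)]`. -/
def Network.avgRate (S : Network N M) (μ : Measure Ω) (Γ : ℕ → Ω → Fin N × Fin M)
    (n : Fin N) : ℝ :=
  liminf (fun T : ℕ => (1 / (T : ℝ)) *
    ∑ t ∈ Finset.range T, ∫ ω, S.service Γ t n ω ∂μ) atTop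

/-- The policy satisfies the throughput constraint. -/
def Network.MeetsThroughput (S : Network N M) (μ : Measure Ω) (Γ : ℕ → Ω → Fin N × Fin M) : Prop :=
  ∀ n, S.Rth ≤ S.avgRate μ Γ n

/-- `P*_id`: the optimum of the power minimization under the throughput constraint, over all
scheduling policies that know the instantaneous channel states of all links. -/
def Network.idealPower (S : Network N M) (μ : Measure Ω) (ℱ : Filtration ℕ mΩ)
    (H : ℕ → Ω → Fin N → ℂ) : ℝ :=
  sInf {p | ∃ Γ : ℕ → Ω → Fin N × Fin M,
    IsPolicy ℱ Γ ∧ S.MeetsThroughput μ Γ ∧ p = S.avgPower μ H Γ}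

/-- The time average of the total backlog, `limsup_T (1/T) ∑_{t ≤ T} ∑_n E[Q_n(t)]`, in `[0, ∞]`. -/
def Network.avgBacklog (S : Network N M) (μ : Measure Ω) (q₀ : Fin N → ℝ)
    (Γ : ℕ → Ω → Fin N × Fin M) : ℝ≥0∞ :=
  limsup (fun T : ℕ => (T : ℝ≥0∞)⁻¹ *
    ∑ t ∈ Finset.range T, ∑ n, ∫⁻ ω, ENNReal.ofReal (S.queue q₀ Γ t n ω) ∂μ) atTop

/-- Every virtual queue is strongly stable: `limsup_T (1/T) ∑_{t ≤ T} E[Q_n(t)] < ∞`. -/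
def Network.StronglyStable (S : Network N M) (μ : Measure Ω) (q₀ : Fin N → ℝ)
    (Γ : ℕ → Ω → Fin N × Fin M) : Prop :=
  ∀ n, limsup (fun T : ℕ => (T : ℝ≥0∞)⁻¹ *
    ∑ t ∈ Finset.range T, ∫⁻ ω, ENNReal.ofReal (S.queue q₀ Γ t n ω) ∂μ) atTop < ⊤

/-! ### Channel indexing feedback -/

/-- The energy metric `v_n = min_m (V P_{n,m} - Q_n R_m)` of a link with fading coefficient `h` and
backlog `q`. -/
def Network.metric (S : Network N M) (V : ℝ) (n : Fin N) (h : ℂ) (q : ℝ) : ℝ :=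
  ⨅ m, (V * S.power n m h - q * S.rate m)

/-- `v_min = - τ R_th R_M` in the slot with number `τ`. -/
def Network.vmin (S : Network N M) (τ : ℕ) : ℝ := -(τ * S.Rth * S.maxRate)

/-- `v_max = V P_max - R_th R_1` (the values `r = 1`, `f = 0` of the grid parameters, which are only
modified after a collision). -/
def Network.vmax (S : Network N M) (V : ℝ) : ℝ := V * S.Pmax - S.Rth * S.minRate

/-- The grid points `a_j`, `1 ≤ j ≤ K`, that divide `[v_min, v_max]` evenly. -/
def gridPoint (K : ℕ) (vmin vmax : ℝ) (j : ℕ) : ℝ :=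
  vmin + ((j : ℝ) - 1) * ((vmax - vmin) / ((K : ℝ) - 1))

/-- The index `j` of the closest grid point `a_j < v` below the metric `v` (and `1` if there is no
grid point below `v`): this is the resource element on which the CSI indicator is sent. -/
def csiIndex (K : ℕ) (vmin vmax v : ℝ) : ℕ :=
  open Classical in
  max 1 (((Finset.Icc 1 K).filter fun j => gridPoint K vmin vmax j < v).sup id)

/-- The resource element `k_n(t)` used by link `n` in slot `t` (whose number is `t + 1`), when there
are `K t ω` resource elements and the decisions so far were made by `Γ`. -/
def Network.resource (S : Network N M) (V : ℝ) (q₀ : Fin N → ℝ) (H : ℕ → Ω → Fin N → ℂ)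
    (K : ℕ → Ω → ℕ) (Γ : ℕ → Ω → Fin N × Fin M) (t : ℕ) (n : Fin N) (ω : Ω) : ℕ :=
  csiIndex (K t ω) (S.vmin (t + 1)) (S.vmax V) (S.metric V n (H t ω n) (S.queue q₀ Γ t n ω))

/-- No collision in slot `t`: no two links send their CSI indicators on the same resource element. -/
def Network.NoCollision (S : Network N M) (V : ℝ) (q₀ : Fin N → ℝ) (H : ℕ → Ω → Fin N → ℂ)
    (K : ℕ → Ω → ℕ) (Γ : ℕ → Ω → Fin N × Fin M) (t : ℕ) (ω : Ω) : Prop :=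
  ∀ n n', n ≠ n' → S.resource V q₀ H K Γ t n ω ≠ S.resource V q₀ H K Γ t n' ω

/-- Link `n` is the only one that sends on its resource element in slot `t`. -/
def Network.Exclusive (S : Network N M) (V : ℝ) (q₀ : Fin N → ℝ) (H : ℕ → Ω → Fin N → ℂ)
    (K : ℕ → Ω → ℕ) (Γ : ℕ → Ω → Fin N × Fin M) (t : ℕ) (n : Fin N) (ω : Ω) : Prop :=
  ∀ n', n' ≠ n → S.resource V q₀ H K Γ t n' ω ≠ S.resource V q₀ H K Γ t n ω

/-- `Γ` is the distributed scheduling: in each slot, the scheduled link is the one that sends its CSI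
indicator exclusively, on the resource element of lowest index, and its bit rate attains the minimum
in its energy metric. -/
def Network.IsDistributed (S : Network N M) (μ : Measure Ω) (V : ℝ) (q₀ : Fin N → ℝ)
    (H : ℕ → Ω → Fin N → ℂ) (K : ℕ → Ω → ℕ) (Γ : ℕ → Ω → Fin N × Fin M) : Prop :=
  ∀ t, ∀ᵐ ω ∂μ,
    S.Exclusive V q₀ H K Γ t (Γ t ω).1 ω ∧
    (∀ n, S.Exclusive V q₀ H K Γ t n ω →
      S.resource V q₀ H K Γ t (Γ t ω).1 ω ≤ S.resource V q₀ H K Γ t n ω) ∧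
    V * S.power (Γ t ω).1 (Γ t ω).2 (H t ω (Γ t ω).1)
        - S.queue q₀ Γ t (Γ t ω).1 ω * S.rate (Γ t ω).2 =
      S.metric V (Γ t ω).1 (H t ω (Γ t ω).1) (S.queue q₀ Γ t (Γ t ω).1 ω)

end Dynamics

end D2D

end

/-!
Without collisions, the lowest occupied resource element belongs to the link with the least energy
metric, because `csiIndex` is monotone. Hence the scheduled pair minimises `V P_{n,m} - Q_n R_m`
over all links and bit rates, in every slot.

Since the queues `Q(t)` are independent of `H(t)` and the law of `H(t)` does not depend on the slot,
the expected minimum can be compared, for each fixed value of the queues, with what any policy `Γ'`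
achieves in any other slot; averaging over these slots bounds it by
`V avgPower Γ' - ∑ n, E[Q_n(t)] avgRate Γ' n`. Here `Γ'` may depend on the history, so no reduction
to stationary randomised policies is needed.

Inserted in the drift of the quadratic Lyapunov function `L`, this gives
`E[L(t+1)] + V E[P(t)] + ε ∑ n, E[Q_n(t)] ≤ E[L(t)] + C + V avgPower Γ'` whenever
`R_th + ε ≤ avgRate Γ' n` for all `n`. Telescoping with `ε = 0` bounds the average power and shows
`E[Q_n(T)²] = O(T)`, so that `E[Q_n(T)] / T → 0`. As `E[Q_n(T)]` dominates the arrivals `T R_th`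
minus the expected total service, this forces the throughput constraint. Telescoping with `ε > 0`
bounds the average backlog.
-/

namespace D2D

lemma sq_max_sub_zero_add_le {q r a : ℝ} (hq : 0 ≤ q) (hr : 0 ≤ r) (ha : 0 ≤ a) :
    (max (q - r) 0 + a) ^ 2 ≤ q ^ 2 + r ^ 2 + a ^ 2 + 2 * q * (a - r) := by
  have hsq : max (q - r) 0 ^ 2 ≤ (q - r) ^ 2 := sq_le_sq.2 <| by
    simpa using abs_max_le_max_abs_abs (a := q - r) (b := 0)
  have hle : max (q - r) 0 ≤ q := max_le (by linarith) hq
  nlinarith [mul_le_mul_of_nonneg_left hle ha]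

section TimeAverages

/-- The average of the first `T` terms of a sequence (`0` for `T = 0`), as it occurs in
`Network.avgPower` and `Network.avgRate`. -/
noncomputable def timeAvg (f : ℕ → ℝ) (T : ℕ) : ℝ :=
  (1 / (T : ℝ)) * ∑ t ∈ Finset.range T, f t

variable {f L : ℕ → ℝ} {A B c : ℝ}

lemma timeAvg_le (hf : ∀ t, f t ≤ B) {T : ℕ} (hT : T ≠ 0) : timeAvg f T ≤ B := by
  have hsum : ∑ t ∈ Finset.range T, f t ≤ T * B := by
    simpa using Finset.sum_le_card_nsmul (Finset.range T) f B fun t _ => hf t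
  rw [timeAvg, one_div, inv_mul_le_iff₀ (by positivity)]
  exact hsum

lemma le_timeAvg (hf : ∀ t, B ≤ f t) {T : ℕ} (hT : T ≠ 0) : B ≤ timeAvg f T := by
  have hsum : T * B ≤ ∑ t ∈ Finset.range T, f t := by
    simpa using Finset.card_nsmul_le_sum (Finset.range T) f B fun t _ => hf t
  rw [timeAvg, one_div, le_inv_mul_iff₀ (by positivity)]
  exact hsum

lemma isBoundedUnder_le_timeAvg (hf : ∀ t, f t ≤ B) :
    atTop.IsBoundedUnder (· ≤ ·) (timeAvg f) :=
  isBoundedUnder_of_eventually_le ((eventually_ne_atTop 0).mono fun _ => timeAvg_le hf)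

lemma isBoundedUnder_ge_timeAvg (hf : ∀ t, B ≤ f t) :
    atTop.IsBoundedUnder (· ≥ ·) (timeAvg f) :=
  isBoundedUnder_of_eventually_ge ((eventually_ne_atTop 0).mono fun _ => le_timeAvg hf)

lemma timeAvg_mul_sub_sum_mul {ι : Type*} [Fintype ι] (c : ℝ) (f : ℕ → ℝ) (w : ι → ℝ)
    (g : ι → ℕ → ℝ) (T : ℕ) :
    timeAvg (fun t => c * f t - ∑ i, w i * g i t) T =
      c * timeAvg f T - ∑ i, w i * timeAvg (g i) T := by
  simp only [timeAvg, Finset.sum_sub_distrib, mul_sub, mul_left_comm _ (1 / (T : ℝ)),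
    ← Finset.mul_sum]
  rw [Finset.sum_comm]
  simp only [Finset.mul_sum]

lemma add_sum_range_le_of_drift_le (h : ∀ t, L (t + 1) + f t ≤ L t + A) (T : ℕ) :
    L T + ∑ t ∈ Finset.range T, f t ≤ L 0 + T * A := by
  induction T with
  | zero => simp
  | succ T ih =>
    rw [Finset.sum_range_succ]
    push_cast
    linarith [h T]

lemma timeAvg_le_of_drift_le (hL : ∀ t, 0 ≤ L t) (hc : 0 < c)
    (h : ∀ t, L (t + 1) + c * f t ≤ L t + A) {T : ℕ} (hT : T ≠ 0) :
    timeAvg f T ≤ A / c + L 0 / c / T := by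
  have hsum := add_sum_range_le_of_drift_le h T
  rw [← Finset.mul_sum] at hsum
  have : (0 : ℝ) < T := by positivity
  calc timeAvg f T = c * ∑ t ∈ Finset.range T, f t / (c * T) := by
        rw [timeAvg, ← Finset.sum_div]; field_simp
    _ ≤ (L 0 + T * A) / (c * T) := by
        rw [← Finset.sum_div, ← mul_div_assoc]
        gcongr
        linarith [hL T]
    _ = A / c + L 0 / c / T := by field_simp; ring

lemma tendsto_const_add_div_natCast (A B : ℝ) :
    Tendsto (fun T : ℕ => A + B / T) atTop (nhds A) := by
  simpa using tendsto_const_nhds.add (tendsto_const_div_atTop_nhds_zero_nat B)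

lemma isBoundedUnder_le_timeAvg_of_drift_le (hL : ∀ t, 0 ≤ L t) (hc : 0 < c)
    (h : ∀ t, L (t + 1) + c * f t ≤ L t + A) : atTop.IsBoundedUnder (· ≤ ·) (timeAvg f) :=
  (tendsto_const_add_div_natCast (A / c) (L 0 / c)).isBoundedUnder_le.mono_le
    ((eventually_ne_atTop 0).mono fun _ => timeAvg_le_of_drift_le hL hc h)

lemma limsup_timeAvg_le_of_drift_le (hL : ∀ t, 0 ≤ L t) (hf : ∀ t, 0 ≤ f t) (hc : 0 < c)
    (h : ∀ t, L (t + 1) + c * f t ≤ L t + A) : limsup (timeAvg f) atTop ≤ A / c := by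
  have hlim := tendsto_const_add_div_natCast (A / c) (L 0 / c)
  rw [← hlim.limsup_eq]
  exact limsup_le_limsup
    ((eventually_ne_atTop 0).mono fun _ => timeAvg_le_of_drift_le hL hc h)
    (isBoundedUnder_ge_timeAvg hf).isCoboundedUnder_le hlim.isBoundedUnder_le

lemma tendsto_div_natCast_zero_of_sq_le {a : ℕ → ℝ} (h : ∀ T, a T ^ 2 ≤ B + T * A) :
    Tendsto (fun T => a T / T) atTop (nhds 0) := by
  have hsqrt : Tendsto (fun T : ℕ => √(B / T / T + A / T)) atTop (nhds 0) := by
    have hB : Tendsto (fun T : ℕ => B / T / T) atTop (nhds 0) := by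
      simpa using (tendsto_const_div_atTop_nhds_zero_nat B).div_atTop tendsto_natCast_atTop_atTop
    simpa using (hB.add (tendsto_const_div_atTop_nhds_zero_nat A)).sqrt
  refine squeeze_zero_norm' ?_ hsqrt
  filter_upwards [eventually_ne_atTop 0] with T hT
  refine Real.abs_le_sqrt ?_
  calc (a T / T) ^ 2 ≤ (B + T * A) / (T : ℝ) ^ 2 := by rw [div_pow]; gcongr; exact h T
    _ = B / T / T + A / T := by field_simp

lemma le_mul_limsup_sub_sum_mul_liminf {α ι : Type*} [Fintype ι] {l : Filter α} [l.NeBot]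
    {u : α → ℝ} {v : ι → α → ℝ} {w : ι → ℝ} (hu : l.IsBoundedUnder (· ≤ ·) u)
    (hv : ∀ i, l.IsBoundedUnder (· ≥ ·) (v i)) (hc : 0 ≤ c) (hw : ∀ i, 0 ≤ w i)
    (h : ∀ᶠ x in l, A ≤ c * u x - ∑ i, w i * v i x) :
    A ≤ c * limsup u l - ∑ i, w i * liminf (v i) l := by
  have happrox : ∀ δ > 0, A ≤ c * (limsup u l + δ) - ∑ i, w i * (liminf (v i) l - δ) := by
    intro δ hδ
    have hlimsup := eventually_lt_of_limsup_lt (lt_add_of_pos_right (limsup u l) hδ) hu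
    have hliminf := eventually_all.2 fun i =>
      eventually_lt_of_lt_liminf (sub_lt_self (liminf (v i) l) hδ) (hv i)
    obtain ⟨x, hx, hux, hvx⟩ := (h.and (hlimsup.and hliminf)).exists
    refine hx.trans ?_
    gcongr with i
    · exact hw i
    · exact (hvx i).le
  have hcont : Tendsto
      (fun δ => c * (limsup u l + δ) - ∑ i, w i * (liminf (v i) l - δ)) (nhdsWithin 0 (Set.Ioi 0))
      (nhds (c * (limsup u l + 0) - ∑ i, w i * (liminf (v i) l - 0))) :=
    (Continuous.tendsto (by fun_prop) 0).mono_left nhdsWithin_le_nhds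
  simp only [add_zero, sub_zero] at hcont
  exact ge_of_tendsto hcont (eventually_mem_nhdsWithin.mono happrox)

end TimeAverages

section Integration

variable {Ω : Type*} {mΩ : MeasurableSpace Ω} {μ : Measure Ω}

lemma integrable_ciInf {ι : Type*} [Finite ι] {f : ι → Ω → ℝ} (hf : ∀ i, Integrable (f i) μ) :
    Integrable (fun ω => ⨅ i, f i ω) μ := by
  have := Fintype.ofFinite ι
  refine (integrable_finsetSum Finset.univ fun i _ => (hf i).norm).mono'
    (AEMeasurable.iInf fun i => (hf i).aemeasurable).aestronglyMeasurable (ae_of_all _ fun ω => ?_)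
  cases isEmpty_or_nonempty ι
  · simp
  · obtain ⟨i, hi⟩ := exists_eq_ciInf_of_finite (f := fun i => f i ω)
    rw [← hi]
    exact Finset.single_le_sum (f := fun i => ‖f i ω‖) (fun _ _ => norm_nonneg _)
      (Finset.mem_univ i)

lemma sq_integral_le_integral_sq [IsProbabilityMeasure μ] {f : Ω → ℝ} (hf : MemLp f 2 μ) :
    (∫ ω, f ω ∂μ) ^ 2 ≤ ∫ ω, f ω ^ 2 ∂μ := by
  have hvar := variance_nonneg f μ
  rw [variance_eq_sub hf] at hvar
  exact sub_nonneg.1 hvar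

lemma integral_mem_Icc_of_forall_mem_Icc [IsProbabilityMeasure μ] {f : Ω → ℝ} {b : ℝ}
    (hf : ∀ ω, f ω ∈ Set.Icc 0 b) : ∫ ω, f ω ∂μ ∈ Set.Icc 0 b := by
  refine ⟨integral_nonneg fun ω => (hf ω).1, ?_⟩
  simpa using integral_mono_of_nonneg (μ := μ) (ae_of_all _ fun ω => (hf ω).1)
    (integrable_const b) (ae_of_all _ fun ω => (hf ω).2)

lemma integral_le_of_indepFun {α β : Type*} {_ : MeasurableSpace α} {_ : MeasurableSpace β}
    [IsFiniteMeasure μ] {X : Ω → α} {Y : Ω → β} {F : α → β → ℝ} {G : α → ℝ}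
    (hXY : IndepFun X Y μ) (hX : AEMeasurable X μ) (hY : AEMeasurable Y μ)
    (hF : StronglyMeasurable (Function.uncurry F))
    (hint : Integrable (fun ω => F (X ω) (Y ω)) μ) (hG : Integrable (fun ω => G (X ω)) μ)
    (hle : ∀ ω, ∫ ω', F (X ω) (Y ω') ∂μ ≤ G (X ω)) :
    ∫ ω, F (X ω) (Y ω) ∂μ ≤ ∫ ω, G (X ω) ∂μ := by
  have hlaw := (indepFun_iff_map_prod_eq_prod_map_map hX hY).1 hXY
  have hprod : Integrable (Function.uncurry F) ((μ.map X).prod (μ.map Y)) := by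
    rw [← hlaw]
    exact (integrable_map_measure hF.aestronglyMeasurable (hX.prodMk hY)).2 hint
  have hsection : ∀ x, ∫ y, F x y ∂μ.map Y = ∫ ω, F x (Y ω) ∂μ := fun x =>
    integral_map hY (hF.comp_measurable measurable_prodMk_left).aestronglyMeasurable
  have hinner : Integrable (fun x => ∫ y, F x y ∂μ.map Y) (μ.map X) := hprod.integral_prod_left
  calc ∫ ω, F (X ω) (Y ω) ∂μ
      = ∫ p, Function.uncurry F p ∂(μ.map X).prod (μ.map Y) := by
        rw [← hlaw, integral_map (hX.prodMk hY) hF.aestronglyMeasurable]; rfl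
    _ = ∫ ω, ∫ y, F (X ω) y ∂μ.map Y ∂μ := by
        rw [integral_prod _ hprod, ← integral_map hX hinner.aestronglyMeasurable]; rfl
    _ ≤ ∫ ω, G (X ω) ∂μ :=
        integral_mono (hinner.comp_aemeasurable hX) hG fun ω => (hsection _).trans_le (hle ω)

end Integration

variable {N M : ℕ}

lemma Network.rate_le_maxRate (S : Network N M) (m : Fin M) : S.rate m ≤ S.maxRate :=
  le_ciSup (Set.finite_range _).bddAbove m

lemma Network.maxRate_nonneg (S : Network N M) : 0 ≤ S.maxRate :=
  Real.iSup_nonneg S.rate_nonneg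

lemma Network.power_mem_Icc (S : Network N M) (n : Fin N) (m : Fin M) (h : ℂ) :
    S.power n m h ∈ Set.Icc 0 S.Pmax := by
  have hsnr := S.snr_pos m
  have hnoise := S.noise_pos
  have hloss := S.pathLoss_pos n
  unfold Network.power
  split_ifs
  · exact Set.right_mem_Icc.2 S.Pmax_pos.le
  · exact ⟨le_min (by positivity) S.Pmax_pos.le, min_le_right _ _⟩

lemma Network.measurable_power (S : Network N M) (n : Fin N) (m : Fin M) :
    Measurable (S.power n m) :=
  Measurable.ite (measurableSet_singleton 0) measurable_const (by fun_prop)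

/-- The energy metric `V P_{n,m} - Q_n R_m` of a pair `x = (n, m)` for the backlogs `q` and the
fading coefficients `h`; the metric of a link is its minimum over `m`. -/
noncomputable def Network.score (S : Network N M) (V : ℝ) (q : Fin N → ℝ) (h : Fin N → ℂ)
    (x : Fin N × Fin M) : ℝ :=
  V * S.power x.1 x.2 (h x.1) - q x.1 * S.rate x.2

/-- The least energy metric over all pairs of a link and a bit rate, which is the value of the
problem that drift-plus-penalty scheduling solves in each slot. -/
noncomputable def Network.minScore (S : Network N M) (V : ℝ) (q : Fin N → ℝ) (h : Fin N → ℂ) : ℝ :=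
  ⨅ x, S.score V q h x

lemma Network.minScore_le (S : Network N M) (V : ℝ) (q : Fin N → ℝ) (h : Fin N → ℂ)
    (x : Fin N × Fin M) : S.minScore V q h ≤ S.score V q h x :=
  ciInf_le (Set.finite_range _).bddBelow x

lemma Network.minScore_eq_of_forall_le (S : Network N M) {V : ℝ} {q : Fin N → ℝ} {h : Fin N → ℂ}
    {x : Fin N × Fin M} (hx : ∀ y, S.score V q h x ≤ S.score V q h y) :
    S.minScore V q h = S.score V q h x :=
  have : Nonempty (Fin N × Fin M) := ⟨x⟩
  le_antisymm (S.minScore_le V q h x) (le_ciInf hx)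

lemma Network.metric_le_score (S : Network N M) (V : ℝ) (q : Fin N → ℝ) (h : Fin N → ℂ)
    (x : Fin N × Fin M) : S.metric V x.1 (h x.1) (q x.1) ≤ S.score V q h x :=
  ciInf_le (Set.finite_range _).bddBelow x.2

lemma Network.measurable_minScore (S : Network N M) (V : ℝ) :
    Measurable (Function.uncurry (S.minScore V)) := by
  refine Measurable.iInf fun x => ?_
  have hpower := S.measurable_power x.1 x.2
  change Measurable fun p : (Fin N → ℝ) × (Fin N → ℂ) =>
    V * S.power x.1 x.2 (p.2 x.1) - p.1 x.1 * S.rate x.2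
  fun_prop

lemma csiIndex_mono (K : ℕ) (vmin vmax : ℝ) : Monotone (csiIndex K vmin vmax) := by
  classical
  intro v w hvw
  refine max_le_max le_rfl (Finset.sup_mono fun j hj => ?_)
  simp only [Finset.mem_filter] at hj ⊢
  exact ⟨hj.1, hj.2.trans_le hvw⟩

section Dynamics

variable {Ω : Type*} {mΩ : MeasurableSpace Ω} {μ : Measure Ω} {ℱ : Filtration ℕ mΩ}
  {H : ℕ → Ω → Fin N → ℂ} {Γ Γ' : ℕ → Ω → Fin N × Fin M} {V : ℝ} {q₀ : Fin N → ℝ}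

/-- The vector `(Q_1(t), …, Q_N(t))` of virtual queues in a slot. -/
noncomputable def Network.backlog (S : Network N M) (q₀ : Fin N → ℝ) (Γ : ℕ → Ω → Fin N × Fin M)
    (t : ℕ) (ω : Ω) : Fin N → ℝ :=
  fun n => S.queue q₀ Γ t n ω

/-- In each slot, `Γ` schedules almost surely a pair of a link and a bit rate with the least energy
metric among all pairs: this is centralized drift-plus-penalty scheduling. -/
def Network.IsScoreMinimizing (S : Network N M) (μ : Measure Ω) (V : ℝ) (q₀ : Fin N → ℝ)
    (H : ℕ → Ω → Fin N → ℂ) (Γ : ℕ → Ω → Fin N × Fin M) : Prop :=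
  ∀ t, ∀ᵐ ω ∂μ, ∀ x, S.score V (S.backlog q₀ Γ t ω) (H t ω) (Γ t ω) ≤
    S.score V (S.backlog q₀ Γ t ω) (H t ω) x

lemma Network.IsDistributed.isScoreMinimizing {S : Network N M} {K : ℕ → Ω → ℕ}
    (hdist : S.IsDistributed μ V q₀ H K Γ)
    (hcol : ∀ t, ∀ᵐ ω ∂μ, S.NoCollision V q₀ H K Γ t ω) : S.IsScoreMinimizing μ V q₀ H Γ := by
  intro t
  filter_upwards [hdist t, hcol t] with ω ⟨_, hlowest, hrate⟩ hdistinct x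
  refine hrate.le.trans (le_trans ?_ (S.metric_le_score V (S.backlog q₀ Γ t ω) (H t ω) x))
  rcases eq_or_ne x.1 (Γ t ω).1 with hx | hx
  · rw [hx]; rfl
  · by_contra! hlt
    have hindex : S.resource V q₀ H K Γ t x.1 ω ≤ S.resource V q₀ H K Γ t (Γ t ω).1 ω :=
      csiIndex_mono _ _ _ hlt.le
    exact hdistinct _ _ hx
      (hindex.antisymm (hlowest x.1 fun n hn => hdistinct n x.1 hn))

lemma Network.service_mem_Icc (S : Network N M) (Γ : ℕ → Ω → Fin N × Fin M) (t : ℕ) (n : Fin N)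
    (ω : Ω) : S.service Γ t n ω ∈ Set.Icc 0 S.maxRate := by
  unfold Network.service
  split_ifs
  · exact ⟨S.rate_nonneg _, S.rate_le_maxRate _⟩
  · exact Set.left_mem_Icc.2 S.maxRate_nonneg

lemma Network.txPower_mem_Icc (S : Network N M) (H : ℕ → Ω → Fin N → ℂ)
    (Γ : ℕ → Ω → Fin N × Fin M) (t : ℕ) (n : Fin N) (ω : Ω) :
    S.txPower H Γ t n ω ∈ Set.Icc 0 S.Pmax := by
  unfold Network.txPower
  split_ifs
  · exact S.power_mem_Icc _ _ _
  · exact Set.left_mem_Icc.2 S.Pmax_pos.le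

lemma Network.sum_service_sq_le (S : Network N M) (Γ : ℕ → Ω → Fin N × Fin M) (t : ℕ) (ω : Ω) :
    ∑ n, S.service Γ t n ω ^ 2 ≤ S.maxRate ^ 2 := by
  have hsum : ∑ n, S.service Γ t n ω ^ 2 = S.rate (Γ t ω).2 ^ 2 := by
    simp [Network.service, ite_pow]
  rw [hsum]
  exact pow_le_pow_left₀ (S.rate_nonneg _) (S.rate_le_maxRate _) 2

lemma Network.score_eq_sum (S : Network N M) (V : ℝ) (q : Fin N → ℝ) (H : ℕ → Ω → Fin N → ℂ)
    (Γ : ℕ → Ω → Fin N × Fin M) (t : ℕ) (ω : Ω) :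
    S.score V q (H t ω) (Γ t ω) =
      V * ∑ n, S.txPower H Γ t n ω - ∑ n, q n * S.service Γ t n ω := by
  simp [Network.score, Network.service, Network.txPower]

lemma IsPolicy.measurable (hΓ : IsPolicy ℱ Γ) (t : ℕ) : Measurable (Γ t) :=
  (hΓ t).mono (ℱ.le t) le_rfl

lemma IsChannel.measurable (hH : IsChannel μ ℱ H) (t : ℕ) : Measurable (H t) :=
  (hH.adapted t).mono (ℱ.le t) le_rfl

lemma Network.measurable_service (S : Network N M) {t : ℕ} (hΓ : Measurable (Γ t)) (n : Fin N) :
    Measurable (S.service Γ t n) :=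
  (measurable_of_countable fun x : Fin N × Fin M => if x.1 = n then S.rate x.2 else 0).comp hΓ

lemma Network.measurable_txPower (S : Network N M) {t : ℕ} (hH : Measurable (H t))
    (hΓ : Measurable (Γ t)) (n : Fin N) : Measurable (S.txPower H Γ t n) := by
  have hpower : Measurable fun p : (Fin N × Fin M) × (Fin N → ℂ) => S.power n p.1.2 (p.2 n) :=
    measurable_from_prod_countable_right fun x =>
      (S.measurable_power n x.2).comp (measurable_pi_apply n)
  exact Measurable.ite (hΓ (measurableSet_eq_fun measurable_fst measurable_const))
    (hpower.comp (hΓ.prodMk hH)) measurable_const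

lemma Network.measurable_queue (S : Network N M) (q₀ : Fin N → ℝ) {t : ℕ}
    (hΓ : ∀ s < t, Measurable (Γ s)) (n : Fin N) : Measurable (S.queue q₀ Γ t n) := by
  induction t with
  | zero => exact measurable_const
  | succ t ih =>
    have hqueue := ih fun s hs => hΓ s (hs.trans t.lt_succ_self)
    have hservice := S.measurable_service (hΓ t t.lt_succ_self) n
    exact ((hqueue.sub hservice).max measurable_const).add_const S.Rth

lemma IsChannel.indepFun_backlog [IsProbabilityMeasure μ] (hH : IsChannel μ ℱ H)
    (hΓ : IsPolicy ℱ Γ) (S : Network N M) (q₀ : Fin N → ℝ) (t : ℕ) :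
    IndepFun (S.backlog q₀ Γ t) (H t) μ := by
  cases t with
  | zero => exact indepFun_const_left q₀ (H 0)
  | succ t =>
    have hpast : ∀ s < t + 1, Measurable[ℱ t] (Γ s) := fun s hs =>
      (hΓ s).mono (ℱ.mono (Nat.le_of_lt_succ hs)) le_rfl
    have hbacklog : Measurable[ℱ t] (S.backlog q₀ Γ (t + 1)) :=
      @measurable_pi_lambda _ _ _ (ℱ t) _ _ (S.measurable_queue q₀ hpast)
    exact indep_of_indep_of_le_left (hH.indep t).symm hbacklog.comap_le

lemma Network.queue_nonneg (S : Network N M) (hq₀ : ∀ n, 0 ≤ q₀ n)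
    (Γ : ℕ → Ω → Fin N × Fin M) (t : ℕ) (n : Fin N) (ω : Ω) : 0 ≤ S.queue q₀ Γ t n ω := by
  cases t with
  | zero => exact hq₀ n
  | succ t => exact add_nonneg (le_max_right _ _) S.Rth_nonneg

lemma Network.sub_service_add_le_queue_succ (S : Network N M) (q₀ : Fin N → ℝ)
    (Γ : ℕ → Ω → Fin N × Fin M) (t : ℕ) (n : Fin N) (ω : Ω) :
    S.queue q₀ Γ t n ω - S.service Γ t n ω + S.Rth ≤ S.queue q₀ Γ (t + 1) n ω :=
  add_le_add_left (le_max_left _ _) _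

/-- The expected total power `∑_n E[P_n(t)]` in a slot. -/
noncomputable def Network.meanPower (S : Network N M) (μ : Measure Ω) (H : ℕ → Ω → Fin N → ℂ)
    (Γ : ℕ → Ω → Fin N × Fin M) (t : ℕ) : ℝ :=
  ∑ n, ∫ ω, S.txPower H Γ t n ω ∂μ

/-- The expected service rate `E[R_n(t)]` of a link in a slot. -/
noncomputable def Network.meanService (S : Network N M) (μ : Measure Ω)
    (Γ : ℕ → Ω → Fin N × Fin M) (n : Fin N) (t : ℕ) : ℝ :=
  ∫ ω, S.service Γ t n ω ∂μ

/-- The expected virtual queue `E[Q_n(t)]` of a link in a slot. -/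
noncomputable def Network.meanQueue (S : Network N M) (μ : Measure Ω) (q₀ : Fin N → ℝ)
    (Γ : ℕ → Ω → Fin N × Fin M) (n : Fin N) (t : ℕ) : ℝ :=
  ∫ ω, S.queue q₀ Γ t n ω ∂μ

/-- The quadratic Lyapunov function of the vector of virtual queues. -/
noncomputable def lyapunov (q : Fin N → ℝ) : ℝ := (∑ n, q n ^ 2) / 2

/-- The expected Lyapunov function of the virtual queues in a slot. -/
noncomputable def Network.meanLyapunov (S : Network N M) (μ : Measure Ω) (q₀ : Fin N → ℝ)
    (Γ : ℕ → Ω → Fin N × Fin M) (t : ℕ) : ℝ :=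
  ∫ ω, lyapunov (S.backlog q₀ Γ t ω) ∂μ

/-- Every virtual queue is mean rate stable, that is, `E[Q_n(T)] / T` tends to `0`. -/
def Network.MeanRateStable (S : Network N M) (μ : Measure Ω) (q₀ : Fin N → ℝ)
    (Γ : ℕ → Ω → Fin N × Fin M) : Prop :=
  ∀ n, Tendsto (fun T : ℕ => S.meanQueue μ q₀ Γ n T / T) atTop (nhds 0)

section Integrability

variable [IsFiniteMeasure μ]

lemma Network.integrable_txPower (S : Network N M) {t : ℕ} (hH : Measurable (H t))
    (hΓ : Measurable (Γ t)) (n : Fin N) : Integrable (S.txPower H Γ t n) μ :=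
  .of_mem_Icc 0 S.Pmax (S.measurable_txPower hH hΓ n).aemeasurable
    (ae_of_all _ (S.txPower_mem_Icc H Γ t n))

lemma Network.memLp_service (S : Network N M) {t : ℕ} (hΓ : Measurable (Γ t)) (n : Fin N)
    (p : ℝ≥0∞) : MemLp (S.service Γ t n) p μ :=
  memLp_of_bounded (ae_of_all _ (S.service_mem_Icc Γ t n))
    (S.measurable_service hΓ n).aestronglyMeasurable p

lemma Network.memLp_queue (S : Network N M) (q₀ : Fin N → ℝ) {t : ℕ}
    (hΓ : ∀ s < t, Measurable (Γ s)) (n : Fin N) (p : ℝ≥0∞) : MemLp (S.queue q₀ Γ t n) p μ := by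
  induction t with
  | zero => exact memLp_const _
  | succ t ih =>
    have hqueue := ih fun s hs => hΓ s (hs.trans t.lt_succ_self)
    exact (hqueue.sub (S.memLp_service (hΓ t t.lt_succ_self) n p)).pos_part.add (memLp_const _)

lemma Network.integrable_score (S : Network N M) (V : ℝ) {q : Ω → Fin N → ℝ} {h : Ω → Fin N → ℂ}
    (hq : ∀ n, Integrable (fun ω => q ω n) μ) (hh : Measurable h) (x : Fin N × Fin M) :
    Integrable (fun ω => S.score V (q ω) (h ω) x) μ := by
  have hpower : Integrable (fun ω => S.power x.1 x.2 (h ω x.1)) μ :=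
    .of_mem_Icc 0 S.Pmax
      ((S.measurable_power x.1 x.2).comp ((measurable_pi_apply x.1).comp hh)).aemeasurable
      (ae_of_all _ fun ω => S.power_mem_Icc x.1 x.2 (h ω x.1))
  exact (hpower.const_mul V).sub ((hq x.1).mul_const _)

lemma Network.integrable_minScore (S : Network N M) (V : ℝ) {q : Ω → Fin N → ℝ}
    {h : Ω → Fin N → ℂ} (hq : ∀ n, Integrable (fun ω => q ω n) μ) (hh : Measurable h) :
    Integrable (fun ω => S.minScore V (q ω) (h ω)) μ :=
  integrable_ciInf (S.integrable_score V hq hh)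

lemma Network.integrable_score_scheduled (S : Network N M) (V : ℝ) {q : Ω → Fin N → ℝ} {t : ℕ}
    (hq : ∀ n, MemLp (fun ω => q ω n) 2 μ) (hH : Measurable (H t)) (hΓ : Measurable (Γ t)) :
    Integrable (fun ω => S.score V (q ω) (H t ω) (Γ t ω)) μ := by
  simp only [S.score_eq_sum]
  exact ((integrable_finsetSum _ fun n _ => S.integrable_txPower hH hΓ n).const_mul V).sub
    (integrable_finsetSum _ fun n _ => (hq n).integrable_mul (S.memLp_service hΓ n 2))

lemma Network.integral_score (S : Network N M) (V : ℝ) (q : Fin N → ℝ) {t : ℕ}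
    (hH : Measurable (H t)) (hΓ : Measurable (Γ t)) :
    ∫ ω, S.score V q (H t ω) (Γ t ω) ∂μ =
      V * S.meanPower μ H Γ t - ∑ n, q n * S.meanService μ Γ n t := by
  have hpower := fun n => S.integrable_txPower (μ := μ) hH hΓ n
  have hservice := fun n => ((S.memLp_service (μ := μ) hΓ n 1).integrable le_rfl).const_mul (q n)
  simp only [S.score_eq_sum]
  rw [integral_sub ((integrable_finsetSum _ fun n _ => hpower n).const_mul V)
    (integrable_finsetSum _ fun n _ => hservice n), integral_const_mul,
    integral_finsetSum _ fun n _ => hpower n, integral_finsetSum _ fun n _ => hservice n]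
  simp only [integral_const_mul, Network.meanPower, Network.meanService]

lemma Network.integrable_lyapunov_backlog (S : Network N M) (q₀ : Fin N → ℝ) {t : ℕ}
    (hΓ : ∀ s < t, Measurable (Γ s)) :
    Integrable (fun ω => lyapunov (S.backlog q₀ Γ t ω)) μ :=
  (integrable_finsetSum _ fun n _ => (S.memLp_queue q₀ hΓ n 2).integrable_sq).div_const 2

end Integrability

lemma lyapunov_nonneg (q : Fin N → ℝ) : 0 ≤ lyapunov q := by
  unfold lyapunov
  positivity

lemma sq_le_two_mul_lyapunov (q : Fin N → ℝ) (n : Fin N) : q n ^ 2 ≤ 2 * lyapunov q := by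
  rw [lyapunov, mul_div_cancel₀ _ two_ne_zero]
  exact Finset.single_le_sum (f := fun n => q n ^ 2) (fun _ _ => sq_nonneg _) (Finset.mem_univ n)

lemma Network.meanLyapunov_nonneg (S : Network N M) (μ : Measure Ω) (q₀ : Fin N → ℝ)
    (Γ : ℕ → Ω → Fin N × Fin M) (t : ℕ) : 0 ≤ S.meanLyapunov μ q₀ Γ t :=
  integral_nonneg fun _ => lyapunov_nonneg _

lemma Network.meanQueue_nonneg (S : Network N M) (μ : Measure Ω) (hq₀ : ∀ n, 0 ≤ q₀ n)
    (Γ : ℕ → Ω → Fin N × Fin M) (n : Fin N) (t : ℕ) : 0 ≤ S.meanQueue μ q₀ Γ n t :=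
  integral_nonneg (S.queue_nonneg hq₀ Γ t n)

lemma Network.stronglyStable_of_avgBacklog_lt_top (S : Network N M)
    (h : S.avgBacklog μ q₀ Γ < ⊤) : S.StronglyStable μ q₀ Γ := by
  refine fun n => (limsup_le_limsup (Eventually.of_forall fun T => ?_)).trans_lt h
  gcongr with t
  exact Finset.single_le_sum (f := fun n => ∫⁻ ω, ENNReal.ofReal (S.queue q₀ Γ t n ω) ∂μ)
    (fun _ _ => zero_le) (Finset.mem_univ n)

variable [IsProbabilityMeasure μ]

lemma Network.meanService_mem_Icc (S : Network N M) (Γ : ℕ → Ω → Fin N × Fin M) (n : Fin N)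
    (t : ℕ) : S.meanService μ Γ n t ∈ Set.Icc 0 S.maxRate :=
  integral_mem_Icc_of_forall_mem_Icc (S.service_mem_Icc Γ t n)

lemma Network.meanPower_mem_Icc (S : Network N M) (H : ℕ → Ω → Fin N → ℂ)
    (Γ : ℕ → Ω → Fin N × Fin M) (t : ℕ) : S.meanPower μ H Γ t ∈ Set.Icc 0 (N * S.Pmax) := by
  have hlink := fun n => integral_mem_Icc_of_forall_mem_Icc (μ := μ) (S.txPower_mem_Icc H Γ t n)
  refine ⟨Finset.sum_nonneg fun n _ => (hlink n).1, ?_⟩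
  simpa [Network.meanPower] using
    Finset.sum_le_card_nsmul Finset.univ _ S.Pmax fun n _ => (hlink n).2

lemma Network.avgPower_nonneg (S : Network N M) (H : ℕ → Ω → Fin N → ℂ)
    (Γ : ℕ → Ω → Fin N × Fin M) : 0 ≤ S.avgPower μ H Γ :=
  le_limsup_of_frequently_le ((eventually_ne_atTop 0).mono fun _ =>
      le_timeAvg fun t => (S.meanPower_mem_Icc H Γ t).1).frequently
    (isBoundedUnder_le_timeAvg fun t => (S.meanPower_mem_Icc H Γ t).2)

lemma IsChannel.integral_minScore_le_slot (hH : IsChannel μ ℱ H) (hΓ : IsPolicy ℱ Γ)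
    (S : Network N M) (V : ℝ) (q : Fin N → ℝ) (s t : ℕ) :
    ∫ ω, S.minScore V q (H t ω) ∂μ ≤
      V * S.meanPower μ H Γ s - ∑ n, q n * S.meanService μ Γ n s := by
  have hlaw : IdentDistrib (H t) (H s) μ μ := (hH.identDistrib t).trans (hH.identDistrib s).symm
  have hmeas : Measurable (S.minScore V q) := (S.measurable_minScore V).of_uncurry_left
  calc ∫ ω, S.minScore V q (H t ω) ∂μ
      = ∫ ω, S.minScore V q (H s ω) ∂μ := (hlaw.comp hmeas).integral_eq
    _ ≤ ∫ ω, S.score V q (H s ω) (Γ s ω) ∂μ :=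
        integral_mono (S.integrable_minScore V (fun n => integrable_const (q n)) (hH.measurable s))
          (S.integrable_score_scheduled V (fun n => memLp_const (q n)) (hH.measurable s)
            (hΓ.measurable s))
          fun ω => S.minScore_le V q (H s ω) (Γ s ω)
    _ = _ := S.integral_score V q (hH.measurable s) (hΓ.measurable s)

lemma IsChannel.integral_minScore_le (hH : IsChannel μ ℱ H) (hΓ : IsPolicy ℱ Γ) (S : Network N M)
    (hV : 0 ≤ V) {q : Fin N → ℝ} (hq : ∀ n, 0 ≤ q n) (t : ℕ) :
    ∫ ω, S.minScore V q (H t ω) ∂μ ≤ V * S.avgPower μ H Γ - ∑ n, q n * S.avgRate μ Γ n := by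
  refine le_mul_limsup_sub_sum_mul_liminf
    (isBoundedUnder_le_timeAvg fun s => (S.meanPower_mem_Icc H Γ s).2)
    (fun n => isBoundedUnder_ge_timeAvg fun s => (S.meanService_mem_Icc Γ n s).1) hV hq ?_
  filter_upwards [eventually_ne_atTop 0] with T hT
  exact (le_timeAvg (fun s => hH.integral_minScore_le_slot hΓ S V q s t) hT).trans_eq
    (timeAvg_mul_sub_sum_mul V (S.meanPower μ H Γ) q (S.meanService μ Γ) T)

lemma IsChannel.integral_minScore_backlog_le (hH : IsChannel μ ℱ H) (hΓ : IsPolicy ℱ Γ)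
    (hΓ' : IsPolicy ℱ Γ') (S : Network N M) (hV : 0 ≤ V) (hq₀ : ∀ n, 0 ≤ q₀ n) (t : ℕ) :
    ∫ ω, S.minScore V (S.backlog q₀ Γ t ω) (H t ω) ∂μ ≤
      V * S.avgPower μ H Γ' - ∑ n, S.meanQueue μ q₀ Γ n t * S.avgRate μ Γ' n := by
  have hmeas : Measurable (S.backlog q₀ Γ t) :=
    measurable_pi_lambda _ (S.measurable_queue q₀ fun s _ => hΓ.measurable s)
  have hqueue : ∀ n, Integrable (fun ω => S.backlog q₀ Γ t ω n) μ := fun n =>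
    (S.memLp_queue q₀ (fun s _ => hΓ.measurable s) n 1).integrable le_rfl
  have hsum : Integrable (fun ω => ∑ n, S.backlog q₀ Γ t ω n * S.avgRate μ Γ' n) μ :=
    integrable_finsetSum _ fun n _ => (hqueue n).mul_const _
  calc ∫ ω, S.minScore V (S.backlog q₀ Γ t ω) (H t ω) ∂μ
      ≤ ∫ ω, (V * S.avgPower μ H Γ' - ∑ n, S.backlog q₀ Γ t ω n * S.avgRate μ Γ' n) ∂μ :=
        integral_le_of_indepFun
          (G := fun q : Fin N → ℝ => V * S.avgPower μ H Γ' - ∑ n, q n * S.avgRate μ Γ' n)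
          (hH.indepFun_backlog hΓ S q₀ t)
          hmeas.aemeasurable (hH.measurable t).aemeasurable
          (S.measurable_minScore V).stronglyMeasurable
          (S.integrable_minScore V hqueue (hH.measurable t)) ((integrable_const _).sub hsum)
          fun ω => hH.integral_minScore_le hΓ' S hV (q := S.backlog q₀ Γ t ω)
            (fun n => S.queue_nonneg hq₀ Γ t n ω) t
    _ = _ := by
        rw [integral_sub (integrable_const _) hsum,
          integral_finsetSum _ fun n _ => (hqueue n).mul_const _]
        simp [integral_mul_const, Network.backlog, Network.meanQueue]

lemma Network.IsScoreMinimizing.integral_score_le {S : Network N M}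
    (hmin : S.IsScoreMinimizing μ V q₀ H Γ) (hH : IsChannel μ ℱ H) (hΓ : IsPolicy ℱ Γ)
    (hΓ' : IsPolicy ℱ Γ') (hV : 0 ≤ V) (hq₀ : ∀ n, 0 ≤ q₀ n) (t : ℕ) :
    ∫ ω, S.score V (S.backlog q₀ Γ t ω) (H t ω) (Γ t ω) ∂μ ≤
      V * S.avgPower μ H Γ' - ∑ n, S.meanQueue μ q₀ Γ n t * S.avgRate μ Γ' n := by
  rw [← integral_congr_ae ((hmin t).mono fun ω => S.minScore_eq_of_forall_le)]
  exact hH.integral_minScore_backlog_le hΓ hΓ' S hV hq₀ t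

lemma Network.lyapunov_succ_add_penalty_le (S : Network N M) (V : ℝ) (hq₀ : ∀ n, 0 ≤ q₀ n)
    (H : ℕ → Ω → Fin N → ℂ) (Γ : ℕ → Ω → Fin N × Fin M) (t : ℕ) (ω : Ω) :
    lyapunov (S.backlog q₀ Γ (t + 1) ω) + V * ∑ n, S.txPower H Γ t n ω ≤
      lyapunov (S.backlog q₀ Γ t ω) + S.C + S.Rth * ∑ n, S.queue q₀ Γ t n ω +
        S.score V (S.backlog q₀ Γ t ω) (H t ω) (Γ t ω) := by
  have hqueue : ∑ n, S.queue q₀ Γ (t + 1) n ω ^ 2 ≤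
      ∑ n, (S.queue q₀ Γ t n ω ^ 2 + S.service Γ t n ω ^ 2 + S.Rth ^ 2 +
        2 * S.queue q₀ Γ t n ω * (S.Rth - S.service Γ t n ω)) :=
    Finset.sum_le_sum fun n _ => sq_max_sub_zero_add_le (S.queue_nonneg hq₀ Γ t n ω)
      (S.service_mem_Icc Γ t n ω).1 S.Rth_nonneg
  have hcross : ∑ n, 2 * S.queue q₀ Γ t n ω * (S.Rth - S.service Γ t n ω) =
      2 * (S.Rth * ∑ n, S.queue q₀ Γ t n ω -
        ∑ n, S.queue q₀ Γ t n ω * S.service Γ t n ω) := by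
    rw [Finset.mul_sum, ← Finset.sum_sub_distrib, Finset.mul_sum]
    exact Finset.sum_congr rfl fun n _ => by ring
  simp only [Finset.sum_add_distrib, hcross, Finset.sum_const, Finset.card_univ, Fintype.card_fin,
    nsmul_eq_mul] at hqueue
  simp only [S.score_eq_sum, lyapunov, Network.backlog, Network.C]
  linarith [S.sum_service_sq_le Γ t ω]

lemma IsPolicy.meanLyapunov_succ_add_penalty_le (hΓ : IsPolicy ℱ Γ) (hH : IsChannel μ ℱ H)
    (S : Network N M) (V : ℝ) (hq₀ : ∀ n, 0 ≤ q₀ n) (t : ℕ) :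
    S.meanLyapunov μ q₀ Γ (t + 1) + V * S.meanPower μ H Γ t ≤
      S.meanLyapunov μ q₀ Γ t + S.C + S.Rth * ∑ n, S.meanQueue μ q₀ Γ n t +
        ∫ ω, S.score V (S.backlog q₀ Γ t ω) (H t ω) (Γ t ω) ∂μ := by
  have hpower := fun n => S.integrable_txPower (μ := μ) (hH.measurable t) (hΓ.measurable t) n
  have hqueue := fun n => S.memLp_queue (μ := μ) q₀ (t := t) (fun s _ => hΓ.measurable s) n
  have hlyap := fun t =>
    S.integrable_lyapunov_backlog (μ := μ) q₀ (t := t) fun s _ => hΓ.measurable s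
  have hscore := S.integrable_score_scheduled V (fun n => hqueue n 2) (hH.measurable t)
    (hΓ.measurable t)
  have hqueue₁ := fun n => (hqueue n 1).integrable le_rfl
  have hpenalty := (integrable_finsetSum Finset.univ fun n _ => hpower n).const_mul V
  have harrival := (integrable_finsetSum Finset.univ fun n _ => hqueue₁ n).const_mul S.Rth
  have hlyapC := (hlyap t).add (integrable_const S.C)
  have hmono := integral_mono ((hlyap (t + 1)).add hpenalty) ((hlyapC.add harrival).add hscore)
    (S.lyapunov_succ_add_penalty_le V hq₀ H Γ t)
  rw [integral_add' (hlyap (t + 1)) hpenalty, integral_add' (hlyapC.add harrival) hscore,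
    integral_add' hlyapC harrival, integral_add' (hlyap t) (integrable_const S.C),
    integral_const_mul, integral_const_mul, integral_finsetSum _ fun n _ => hpower n,
    integral_finsetSum _ fun n _ => hqueue₁ n, integral_const, probReal_univ, one_smul] at hmono
  exact hmono

lemma Network.IsScoreMinimizing.meanLyapunov_drift_le {S : Network N M}
    (hmin : S.IsScoreMinimizing μ V q₀ H Γ) (hH : IsChannel μ ℱ H) (hΓ : IsPolicy ℱ Γ)
    (hΓ' : IsPolicy ℱ Γ') (hV : 0 ≤ V) (hq₀ : ∀ n, 0 ≤ q₀ n) {ε : ℝ}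
    (hrate : ∀ n, S.Rth + ε ≤ S.avgRate μ Γ' n) (t : ℕ) :
    S.meanLyapunov μ q₀ Γ (t + 1) + V * S.meanPower μ H Γ t +
        ε * ∑ n, S.meanQueue μ q₀ Γ n t ≤
      S.meanLyapunov μ q₀ Γ t + (S.C + V * S.avgPower μ H Γ') := by
  have hdrift := hΓ.meanLyapunov_succ_add_penalty_le hH S V hq₀ t
  have hscore := hmin.integral_score_le hH hΓ hΓ' hV hq₀ t
  have hservice : (S.Rth + ε) * ∑ n, S.meanQueue μ q₀ Γ n t ≤
      ∑ n, S.meanQueue μ q₀ Γ n t * S.avgRate μ Γ' n := by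
    rw [Finset.mul_sum]
    refine Finset.sum_le_sum fun n _ => ?_
    rw [mul_comm]
    exact mul_le_mul_of_nonneg_left (hrate n) (S.meanQueue_nonneg μ hq₀ Γ n t)
  linarith

lemma Network.IsScoreMinimizing.meanLyapunov_drift_le_of_meetsThroughput {S : Network N M}
    (hmin : S.IsScoreMinimizing μ V q₀ H Γ) (hH : IsChannel μ ℱ H) (hΓ : IsPolicy ℱ Γ)
    (hΓ' : IsPolicy ℱ Γ') (hV : 0 ≤ V) (hq₀ : ∀ n, 0 ≤ q₀ n) (hmeets : S.MeetsThroughput μ Γ')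
    (t : ℕ) :
    S.meanLyapunov μ q₀ Γ (t + 1) + V * S.meanPower μ H Γ t ≤
      S.meanLyapunov μ q₀ Γ t + (S.C + V * S.avgPower μ H Γ') := by
  have hrate : ∀ n, S.Rth + 0 ≤ S.avgRate μ Γ' n := fun n => (add_zero S.Rth).trans_le (hmeets n)
  simpa using hmin.meanLyapunov_drift_le hH hΓ hΓ' hV hq₀ hrate t

lemma Network.IsScoreMinimizing.avgPower_le {S : Network N M}
    (hmin : S.IsScoreMinimizing μ V q₀ H Γ) (hH : IsChannel μ ℱ H) (hΓ : IsPolicy ℱ Γ)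
    (hΓ' : IsPolicy ℱ Γ') (hV : 0 < V) (hq₀ : ∀ n, 0 ≤ q₀ n) (hmeets : S.MeetsThroughput μ Γ') :
    S.avgPower μ H Γ ≤ S.avgPower μ H Γ' + S.C / V := by
  calc S.avgPower μ H Γ ≤ (S.C + V * S.avgPower μ H Γ') / V :=
        limsup_timeAvg_le_of_drift_le (S.meanLyapunov_nonneg μ q₀ Γ)
          (fun t => (S.meanPower_mem_Icc H Γ t).1) hV
          (hmin.meanLyapunov_drift_le_of_meetsThroughput hH hΓ hΓ' hV.le hq₀ hmeets)
    _ = S.avgPower μ H Γ' + S.C / V := by field_simp; ring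

lemma IsPolicy.sq_meanQueue_le (hΓ : IsPolicy ℱ Γ) (S : Network N M) (q₀ : Fin N → ℝ) (n : Fin N)
    (t : ℕ) : S.meanQueue μ q₀ Γ n t ^ 2 ≤ 2 * S.meanLyapunov μ q₀ Γ t := by
  have hqueue : MemLp (S.queue q₀ Γ t n) 2 μ := S.memLp_queue q₀ (fun s _ => hΓ.measurable s) n 2
  have hlyap := S.integrable_lyapunov_backlog (μ := μ) q₀ (t := t) fun s _ => hΓ.measurable s
  calc S.meanQueue μ q₀ Γ n t ^ 2 ≤ ∫ ω, S.queue q₀ Γ t n ω ^ 2 ∂μ :=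
        sq_integral_le_integral_sq hqueue
    _ ≤ ∫ ω, 2 * lyapunov (S.backlog q₀ Γ t ω) ∂μ :=
        integral_mono hqueue.integrable_sq (hlyap.const_mul 2)
          fun ω => sq_le_two_mul_lyapunov (S.backlog q₀ Γ t ω) n
    _ = 2 * S.meanLyapunov μ q₀ Γ t := integral_const_mul _ _

lemma Network.IsScoreMinimizing.meanRateStable {S : Network N M}
    (hmin : S.IsScoreMinimizing μ V q₀ H Γ) (hH : IsChannel μ ℱ H) (hΓ : IsPolicy ℱ Γ)
    (hΓ' : IsPolicy ℱ Γ') (hV : 0 ≤ V) (hq₀ : ∀ n, 0 ≤ q₀ n) (hmeets : S.MeetsThroughput μ Γ') :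
    S.MeanRateStable μ q₀ Γ := by
  have hdrift := hmin.meanLyapunov_drift_le_of_meetsThroughput hH hΓ hΓ' hV hq₀ hmeets
  refine fun n => tendsto_div_natCast_zero_of_sq_le (B := 2 * S.meanLyapunov μ q₀ Γ 0)
    (A := 2 * (S.C + V * S.avgPower μ H Γ')) fun T => ?_
  have hsum := add_sum_range_le_of_drift_le hdrift T
  have hpower : 0 ≤ ∑ t ∈ Finset.range T, V * S.meanPower μ H Γ t :=
    Finset.sum_nonneg fun t _ => mul_nonneg hV (S.meanPower_mem_Icc H Γ t).1
  linarith [hΓ.sq_meanQueue_le (μ := μ) S q₀ n T]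

lemma IsPolicy.add_mul_sub_sum_meanService_le (hΓ : IsPolicy ℱ Γ) (S : Network N M)
    (q₀ : Fin N → ℝ) (n : Fin N) (T : ℕ) :
    q₀ n + T * S.Rth - ∑ t ∈ Finset.range T, S.meanService μ Γ n t ≤ S.meanQueue μ q₀ Γ n T := by
  induction T with
  | zero => simp [Network.meanQueue, Network.queue]
  | succ T ih =>
    have hqueue := fun t => (S.memLp_queue (μ := μ) q₀ (t := t) (fun s _ => hΓ.measurable s) n
      1).integrable le_rfl
    have hservice := (S.memLp_service (μ := μ) (hΓ.measurable T) n 1).integrable le_rfl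
    have hstep := integral_mono (((hqueue T).sub hservice).add (integrable_const S.Rth))
      (hqueue (T + 1)) (S.sub_service_add_le_queue_succ q₀ Γ T n)
    rw [integral_add' ((hqueue T).sub hservice) (integrable_const _),
      integral_sub' (hqueue T) hservice, integral_const, probReal_univ, one_smul] at hstep
    rw [Finset.sum_range_succ]
    push_cast
    simp only [Network.meanQueue, Network.meanService] at ih ⊢
    linarith

lemma Network.MeanRateStable.meetsThroughput {S : Network N M} (hstable : S.MeanRateStable μ q₀ Γ)
    (hΓ : IsPolicy ℱ Γ) : S.MeetsThroughput μ Γ := by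
  intro n
  have hlim : Tendsto (fun T : ℕ => S.Rth + q₀ n / T - S.meanQueue μ q₀ Γ n T / T) atTop
      (nhds S.Rth) := by
    simpa using (tendsto_const_add_div_natCast S.Rth (q₀ n)).sub (hstable n)
  rw [← hlim.liminf_eq]
  refine liminf_le_liminf ?_ hlim.isBoundedUnder_ge
    (isBoundedUnder_le_timeAvg fun t => (S.meanService_mem_Icc Γ n t).2).isCoboundedUnder_ge
  filter_upwards [eventually_ne_atTop 0] with T hT
  have : (0 : ℝ) < T := by positivity
  have hgrowth := hΓ.add_mul_sub_sum_meanService_le (μ := μ) S q₀ n T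
  calc S.Rth + q₀ n / T - S.meanQueue μ q₀ Γ n T / T
      = (q₀ n + T * S.Rth - S.meanQueue μ q₀ Γ n T) / T := by field_simp; ring
    _ ≤ (∑ t ∈ Finset.range T, S.meanService μ Γ n t) / T := by gcongr; linarith
    _ = 1 / (T : ℝ) * ∑ t ∈ Finset.range T, S.meanService μ Γ n t := by ring

lemma IsPolicy.avgBacklog_eq_limsup (hΓ : IsPolicy ℱ Γ) (S : Network N M)
    (hq₀ : ∀ n, 0 ≤ q₀ n) :
    S.avgBacklog μ q₀ Γ =
      limsup (fun T => ENNReal.ofReal (timeAvg (fun t => ∑ n, S.meanQueue μ q₀ Γ n t) T))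
        atTop := by
  have hmean : ∀ t n, ∫⁻ ω, ENNReal.ofReal (S.queue q₀ Γ t n ω) ∂μ =
      ENNReal.ofReal (S.meanQueue μ q₀ Γ n t) := fun t n =>
    (ofReal_integral_eq_lintegral_ofReal
      ((S.memLp_queue q₀ (fun s _ => hΓ.measurable s) n 1).integrable le_rfl)
      (ae_of_all _ (S.queue_nonneg hq₀ Γ t n))).symm
  have hnonneg := S.meanQueue_nonneg μ hq₀ Γ
  refine limsup_congr ((eventually_ne_atTop 0).mono fun T hT => ?_)
  simp only [hmean]
  rw [timeAvg, one_div, ENNReal.ofReal_mul (by positivity),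
    ENNReal.ofReal_inv_of_pos (by positivity), ENNReal.ofReal_natCast,
    ENNReal.ofReal_sum_of_nonneg fun t _ => Finset.sum_nonneg fun n _ => hnonneg n t]
  simp only [ENNReal.ofReal_sum_of_nonneg fun n _ => hnonneg n _]

lemma Network.IsScoreMinimizing.avgBacklog_le {S : Network N M}
    (hmin : S.IsScoreMinimizing μ V q₀ H Γ) (hH : IsChannel μ ℱ H) (hΓ : IsPolicy ℱ Γ)
    (hΓ' : IsPolicy ℱ Γ') (hV : 0 ≤ V) (hq₀ : ∀ n, 0 ≤ q₀ n) {ε : ℝ} (hε : 0 < ε)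
    (hrate : ∀ n, S.Rth + ε ≤ S.avgRate μ Γ' n) :
    S.avgBacklog μ q₀ Γ ≤ ENNReal.ofReal ((S.C + V * S.avgPower μ H Γ') / ε) := by
  have hdrift : ∀ t, S.meanLyapunov μ q₀ Γ (t + 1) + ε * ∑ n, S.meanQueue μ q₀ Γ n t ≤
      S.meanLyapunov μ q₀ Γ t + (S.C + V * S.avgPower μ H Γ') := fun t => by
    linarith [hmin.meanLyapunov_drift_le hH hΓ hΓ' hV hq₀ hrate t,
      mul_nonneg hV (S.meanPower_mem_Icc (μ := μ) H Γ t).1]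
  have hlyap := S.meanLyapunov_nonneg μ q₀ Γ
  have hbacklog : ∀ t, 0 ≤ ∑ n, S.meanQueue μ q₀ Γ n t := fun t =>
    Finset.sum_nonneg fun n _ => S.meanQueue_nonneg μ hq₀ Γ n t
  rw [hΓ.avgBacklog_eq_limsup S hq₀, ← ENNReal.ofReal_limsup
    (isBoundedUnder_ge_timeAvg hbacklog).isCoboundedUnder_le
    (isBoundedUnder_le_timeAvg_of_drift_le hlyap hε hdrift)]
  exact ENNReal.ofReal_le_ofReal (limsup_timeAvg_le_of_drift_le hlyap hbacklog hε hdrift)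

lemma IsPolicy.idealPower_le_avgPower (hΓ : IsPolicy ℱ Γ) {S : Network N M}
    (hmeets : S.MeetsThroughput μ Γ) (H : ℕ → Ω → Fin N → ℂ) :
    S.idealPower μ ℱ H ≤ S.avgPower μ H Γ := by
  refine csInf_le ⟨0, ?_⟩ ⟨Γ, hΓ, hmeets, rfl⟩
  rintro _ ⟨Γ', -, -, rfl⟩
  exact S.avgPower_nonneg H Γ'

lemma Network.IsScoreMinimizing.avgPower_le_idealPower_add {S : Network N M}
    (hmin : S.IsScoreMinimizing μ V q₀ H Γ) (hH : IsChannel μ ℱ H) (hΓ : IsPolicy ℱ Γ)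
    (hfeas : ∃ Γ' : ℕ → Ω → Fin N × Fin M, IsPolicy ℱ Γ' ∧ S.MeetsThroughput μ Γ') (hV : 0 < V)
    (hq₀ : ∀ n, 0 ≤ q₀ n) : S.avgPower μ H Γ ≤ S.idealPower μ ℱ H + S.C / V := by
  obtain ⟨Γ₀, hΓ₀, hmeets₀⟩ := hfeas
  rw [← sub_le_iff_le_add]
  refine le_csInf ⟨_, Γ₀, hΓ₀, hmeets₀, rfl⟩ ?_
  rintro _ ⟨Γ', hΓ', hmeets, rfl⟩
  exact sub_le_iff_le_add.2 (hmin.avgPower_le hH hΓ hΓ' hV hq₀ hmeets)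

end Dynamics

end D2D

theorem mainTheorem1 {N M : ℕ} (S : D2D.Network N M)
    {Ω : Type*} {mΩ : MeasurableSpace Ω} (μ : Measure Ω) [IsProbabilityMeasure μ]
    (ℱ : Filtration ℕ mΩ) (H : ℕ → Ω → Fin N → ℂ) (hH : D2D.IsChannel μ ℱ H)
    (hfeas : ∃ Γ : ℕ → Ω → Fin N × Fin M, D2D.IsPolicy ℱ Γ ∧ S.MeetsThroughput μ Γ)
    (V : ℝ) (hV : 0 < V) (q₀ : Fin N → ℝ) (hq₀ : ∀ n, 0 ≤ q₀ n) (K : ℕ → Ω → ℕ)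
    (Γdist : ℕ → Ω → Fin N × Fin M) (hΓ : D2D.IsPolicy ℱ Γdist)
    (hdist : S.IsDistributed μ V q₀ H K Γdist)
    (hcol : ∀ t, ∀ᵐ ω ∂μ, S.NoCollision V q₀ H K Γdist t ω) :
    S.MeetsThroughput μ Γdist ∧
    S.idealPower μ ℱ H ≤ S.avgPower μ H Γdist ∧
    S.avgPower μ H Γdist ≤ S.idealPower μ ℱ H + S.C / V ∧
    ∀ ε : ℝ, 0 < ε → ∀ Γ : ℕ → Ω → Fin N × Fin M, D2D.IsPolicy ℱ Γ →
      (∀ n, S.Rth + ε ≤ S.avgRate μ Γ n) →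
      S.StronglyStable μ q₀ Γdist ∧
      S.avgBacklog μ q₀ Γdist ≤ ENNReal.ofReal ((S.C + V * S.avgPower μ H Γ) / ε) := by
  have hmin := hdist.isScoreMinimizing hcol
  obtain ⟨Γ₀, hΓ₀, hmeets₀⟩ := hfeas
  have hstable : S.MeanRateStable μ q₀ Γdist := hmin.meanRateStable hH hΓ hΓ₀ hV.le hq₀ hmeets₀
  have hmeets : S.MeetsThroughput μ Γdist := hstable.meetsThroughput hΓ
  refine ⟨hmeets, hΓ.idealPower_le_avgPower hmeets H,
    hmin.avgPower_le_idealPower_add hH hΓ ⟨Γ₀, hΓ₀, hmeets₀⟩ hV hq₀, fun ε hε Γ hΓ' hrate => ?_⟩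
  have hbacklog := hmin.avgBacklog_le hH hΓ hΓ' hV.le hq₀ hε hrate
  exact ⟨S.stronglyStable_of_avgBacklog_lt_top (hbacklog.trans_lt ENNReal.ofReal_lt_top),
    hbacklog⟩
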